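/- **Theorem (Existence and uniqueness in three dimensions).** Let $V\subset\mathbb R^3$ be a bounded open set, let $\nu\in[0,1/2]$ and $\chi=1/(1+\nu)\in[2/3,1]$. Let $H^1_0(V)$ be the closure of $C_c^\infty(V)$ in $H^1(V)$, let $\mathrm{Sym}(3)$ be the symmetric real $3\times 3$ matrices, and let $$X_0(V)=H^1_0(V)\otimes\mathrm{Sym}(3),\qquad \|\sigma\|_X^2=\|\sigma\|_{L^2}^2+\|D\sigma\|_{L^2}^2,$$ where $(D\sigma)_{ijk}=\partial_k\sigma_{ij}$ and $(\operatorname{Div}\sigma)_i=\sum_j\partial_j\sigma_{ij}$ (weak derivatives). For $\tau,\sigma\in X_0(V)$ put $$a(\tau,\sigma)=\int_V\langle D\tau,D\sigma\rangle+\chi\big(\langle\operatorname{Div}\tau,\nabla\operatorname{tr}\sigma\rangle+\langle\nabla\operatorname{tr}\tau,\operatorname{Div}\sigma\rangle\big)\,dV .$$ Then $a$ is a symmetric bilinear form on $X_0(V)$ that is continuous, $|a(\tau,\sigma)|\le(1+6\chi)\|\tau\|_X\|\sigma\|_X$, and coercive: there is a constant $\beta>0$, depending only on $\nu$ and $V$,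 with $a(\sigma,\sigma)\ge\beta\|\sigma\|_X^2$ for all $\sigma\in X_0(V)$. Moreover, for every continuous linear form $l$ on $X_0(V)$ the problem $$a(\tau,\sigma)=l(\tau)\qquad\forall\,\tau\in X_0(V)$$ has a unique solution $\sigma\in X_0(V)$, and it satisfies $\|\sigma\|_X\le\frac1\beta\|l\|_{X'}$, where $\|\cdot\|_{X'}$ is the dual norm with respect to $X_0(V)$. In particular, for every $f\in H^1(V)^3$ the linear form $$l(\tau)=\int_V 2\langle\tau,\operatorname{sym}Df\rangle+\frac{1+\nu^2}{1-\nu^2}\,(\operatorname{tr}\tau)\,(\operatorname{div}f)\,dV,\qquad \operatorname{sym}Df=\tfrac12\big(Df+(Df)^T\big),$$ is continuous on $X_0(V)$, so this applies to it. -/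

import Mathlib

open MeasureTheory
open scoped ContDiff

noncomputable section

namespace StressWellPosed

/-- Three-dimensional Euclidean space. -/
abbrev E3 : Type := EuclideanSpace ℝ (Fin 3)

/-- The `i`-th partial derivative of a function on `ℝ³`. -/
def partialDeriv (i : Fin 3) (φ : E3 → ℝ) (x : E3) : ℝ :=
  fderiv ℝ φ x (EuclideanSpace.single i 1)

/-- Test functions on `V`: smooth functions with compact support contained in `V`. -/
structure IsTestFun (V : Set E3) (φ : E3 → ℝ) : Prop where
  smooth : ContDiff ℝ ∞ φ
  compact : HasCompactSupport φ
  subset : tsupport φ ⊆ V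

/-- The Lebesgue space `L²(V)`. -/
abbrev L2 (V : Set E3) : Type := Lp ℝ 2 (volume.restrict V)

/-- Pairs `(u, g)` of `u ∈ L²(V)` and `g ∈ L²(V)³`, with
`‖(u, g)‖² = ‖u‖² + ∑ᵢ ‖gᵢ‖²`. -/
def L2Pair (V : Set E3) : Type :=
  WithLp 2 (L2 V × PiLp 2 (fun _ : Fin 3 => L2 V))

instance (V : Set E3) : NormedAddCommGroup (L2Pair V) :=
  inferInstanceAs (NormedAddCommGroup (WithLp 2 (L2 V × PiLp 2 (fun _ : Fin 3 => L2 V))))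

instance (V : Set E3) : InnerProductSpace ℝ (L2Pair V) :=
  inferInstanceAs (InnerProductSpace ℝ (WithLp 2 (L2 V × PiLp 2 (fun _ : Fin 3 => L2 V))))

instance (V : Set E3) : CompleteSpace (L2Pair V) :=
  inferInstanceAs (CompleteSpace (WithLp 2 (L2 V × PiLp 2 (fun _ : Fin 3 => L2 V))))

/-- The first entry `u` of a pair `(u, g)`. -/
def L2Pair.fn {V : Set E3} (p : L2Pair V) : L2 V := WithLp.fst p

/-- The entry `gₖ` of a pair `(u, g)`. -/
def L2Pair.grad {V : Set E3} (p : L2Pair V) (k : Fin 3) : L2 V := WithLp.snd p k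

/-- `g` is the weak gradient of `u` in `V`. -/
def IsWeakGradient (V : Set E3) (u : L2 V) (g : Fin 3 → L2 V) : Prop :=
  ∀ (i : Fin 3) (φ : E3 → ℝ), IsTestFun V φ →
    ∫ x in V, u x * partialDeriv i φ x = - ∫ x in V, g i x * φ x

theorem IsTestFun.zero (V : Set E3) : IsTestFun V (0 : E3 → ℝ) :=
  ⟨contDiff_const, HasCompactSupport.zero, by simp [tsupport]⟩

theorem IsTestFun.add {V : Set E3} {φ ψ : E3 → ℝ} (hφ : IsTestFun V φ) (hψ : IsTestFun V ψ) :
    IsTestFun V (φ + ψ) :=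
  ⟨hφ.smooth.add hψ.smooth, hφ.compact.add hψ.compact,
    (tsupport_add φ ψ).trans (Set.union_subset hφ.subset hψ.subset)⟩

theorem IsTestFun.smul {V : Set E3} {φ : E3 → ℝ} (c : ℝ) (hφ : IsTestFun V φ) :
    IsTestFun V (c • φ) :=
  ⟨contDiff_const.smul hφ.smooth, hφ.compact.smul_left (f := fun _ => c),
    (tsupport_smul_subset_right (fun _ => c) φ).trans hφ.subset⟩

theorem integrable_L2_mul {V : Set E3} (u : L2 V) {ψ : E3 → ℝ} (hc : Continuous ψ)
    (hs : HasCompactSupport ψ) : Integrable (fun x => u x * ψ x) (volume.restrict V) :=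
  MemLp.integrable_mul (p := 2) (q := 2) (Lp.memLp u)
    ((hc.memLp_of_hasCompactSupport hs).restrict V)

theorem IsTestFun.continuous_partialDeriv {V : Set E3} {φ : E3 → ℝ} (hφ : IsTestFun V φ)
    (i : Fin 3) : Continuous (partialDeriv i φ) :=
  (hφ.smooth.continuous_fderiv (by simp)).clm_apply continuous_const

theorem IsTestFun.compact_partialDeriv {V : Set E3} {φ : E3 → ℝ} (hφ : IsTestFun V φ)
    (i : Fin 3) : HasCompactSupport (partialDeriv i φ) :=
  hφ.compact.fderiv_apply (𝕜 := ℝ) _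

/-- The Sobolev space `H¹(V)`: an element is a function `u ∈ L²(V)` together with its (unique)
weak gradient in `L²(V)³`; the inherited norm is `‖u‖²_{H¹} = ‖u‖²_{L²} + ‖∇u‖²_{L²}`. -/
def H1 (V : Set E3) : Submodule ℝ (L2Pair V) where
  carrier := {p | IsWeakGradient V p.fn p.grad}
  zero_mem' := by
    intro i φ hφ
    have h : ∀ᵐ x ∂(volume.restrict V), ((0 : L2 V) x) = 0 := Lp.coeFn_zero _ _ _
    have h1 : ∫ x in V, ((0 : L2 V) x) * partialDeriv i φ x = 0 :=
      integral_eq_zero_of_ae (by filter_upwards [h] with x hx; rw [hx, zero_mul]; rfl)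
    have h2 : ∫ x in V, ((0 : L2 V) x) * φ x = 0 :=
      integral_eq_zero_of_ae (by filter_upwards [h] with x hx; rw [hx, zero_mul]; rfl)
    change ∫ x in V, ((0 : L2 V) x) * partialDeriv i φ x = - ∫ x in V, ((0 : L2 V) x) * φ x
    rw [h1, h2, neg_zero]
  add_mem' := by
    intro p q hp hq i φ hφ
    have key : ∀ (u v : L2 V) (ψ : E3 → ℝ), Continuous ψ → HasCompactSupport ψ →
        ∫ x in V, (u + v : L2 V) x * ψ x = (∫ x in V, u x * ψ x) + ∫ x in V, v x * ψ x := by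
      intro u v ψ hc hs
      rw [← integral_add (integrable_L2_mul u hc hs) (integrable_L2_mul v hc hs)]
      refine integral_congr_ae ?_
      filter_upwards [Lp.coeFn_add u v] with x hx
      rw [hx, Pi.add_apply, add_mul]
    change ∫ x in V, (p.fn + q.fn : L2 V) x * partialDeriv i φ x
      = - ∫ x in V, (p.grad i + q.grad i : L2 V) x * φ x
    rw [key _ _ _ (hφ.continuous_partialDeriv i) (hφ.compact_partialDeriv i),
      key _ _ _ hφ.smooth.continuous hφ.compact, hp i φ hφ, hq i φ hφ, neg_add]
  smul_mem' := by
    intro c p hp i φ hφ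
    have key : ∀ (u : L2 V) (ψ : E3 → ℝ),
        ∫ x in V, (c • u : L2 V) x * ψ x = c * ∫ x in V, u x * ψ x := by
      intro u ψ
      rw [← integral_const_mul]
      refine integral_congr_ae ?_
      filter_upwards [Lp.coeFn_smul c u] with x hx
      rw [hx, Pi.smul_apply, smul_eq_mul, mul_assoc]
    change ∫ x in V, (c • p.fn : L2 V) x * partialDeriv i φ x
      = - ∫ x in V, (c • p.grad i : L2 V) x * φ x
    rw [key, key, hp i φ hφ, mul_neg]

/-- The underlying `L²` function of `u ∈ H¹(V)`. -/
def h1Fun {V : Set E3} (u : H1 V) : E3 → ℝ := (u : L2Pair V).fn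

/-- The weak partial derivative `∂ₖ u` of `u ∈ H¹(V)`. -/
def h1Deriv {V : Set E3} (u : H1 V) (k : Fin 3) : E3 → ℝ := (u : L2Pair V).grad k

/-- The elements of `H¹(V)` that are represented by a test function. -/
def testH1 (V : Set E3) : Submodule ℝ (H1 V) where
  carrier := {u | ∃ φ : E3 → ℝ, IsTestFun V φ ∧ h1Fun u =ᵐ[volume.restrict V] φ}
  zero_mem' := ⟨0, IsTestFun.zero V, Lp.coeFn_zero _ _ _⟩
  add_mem' := by
    rintro u v ⟨φ, hφ, hu⟩ ⟨ψ, hψ, hv⟩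
    exact ⟨φ + ψ, hφ.add hψ, (Lp.coeFn_add _ _).trans (hu.add hv)⟩
  smul_mem' := by
    rintro c u ⟨φ, hφ, hu⟩
    exact ⟨c • φ, hφ.smul c, (Lp.coeFn_smul _ _).trans (hu.const_smul c)⟩

/-- `H¹₀(V)`, the closure of the test functions in `H¹(V)`. -/
def H10 (V : Set E3) : Submodule ℝ (H1 V) := (testH1 V).topologicalClosure

/-- `X₀(V) = H¹₀(V) ⊗ Sym(3)`: symmetric `3 × 3` tensors with components in `H¹₀(V)`. The
inherited norm is `‖σ‖²_X = ∑ᵢⱼ ‖σᵢⱼ‖²_{H¹} = ‖σ‖²_{L²} + ‖Dσ‖²_{L²}`. -/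
def X0 (V : Set E3) : Submodule ℝ (PiLp 2 (fun _ : Fin 3 × Fin 3 => L2Pair V)) where
  carrier := {σ | ∀ i j, σ (i, j) ∈ (H10 V).map (H1 V).subtype ∧ σ (i, j) = σ (j, i)}
  zero_mem' := fun _ _ => ⟨Submodule.zero_mem _, rfl⟩
  add_mem' := by
    intro σ τ hσ hτ i j
    refine ⟨Submodule.add_mem _ (hσ i j).1 (hτ i j).1, ?_⟩
    simp only [PiLp.add_apply]
    rw [(hσ i j).2, (hτ i j).2]
  smul_mem' := by
    intro c σ hσ i j
    refine ⟨Submodule.smul_mem _ c (hσ i j).1, ?_⟩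
    simp only [PiLp.smul_apply]
    rw [(hσ i j).2]

/-- The component `σᵢⱼ ∈ H¹(V)`. -/
def comp {V : Set E3} (σ : X0 V) (i j : Fin 3) : H1 V :=
  ⟨(σ : PiLp 2 (fun _ : Fin 3 × Fin 3 => L2Pair V)) (i, j),
    Submodule.map_subtype_le (H1 V) (H10 V) (σ.2 i j).1⟩

/-- The tensor gradient `(Dσ)ᵢⱼₖ = ∂ₖ σᵢⱼ`. -/
def tensorD {V : Set E3} (σ : X0 V) (x : E3) (i j k : Fin 3) : ℝ := h1Deriv (comp σ i j) k x

/-- The row-wise divergence `(Div σ)ᵢ = ∑ⱼ ∂ⱼ σᵢⱼ`. -/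
def tensorDiv {V : Set E3} (σ : X0 V) (x : E3) (i : Fin 3) : ℝ :=
  ∑ j, h1Deriv (comp σ i j) j x

/-- The trace `tr σ ∈ H¹(V)`. -/
def trace {V : Set E3} (σ : X0 V) : H1 V := ∑ i, comp σ i i

/-- The gradient of the trace, `(∇ tr σ)ₖ = ∂ₖ (tr σ)`. -/
def gradTrace {V : Set E3} (σ : X0 V) (x : E3) (k : Fin 3) : ℝ := h1Deriv (trace σ) k x

/-- The material parameter `χ = 1 / (1 + ν)`. -/
def chi (ν : ℝ) : ℝ := 1 / (1 + ν)

/-- The bilinear form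
`a(τ, σ) = ∫_V ⟨Dτ, Dσ⟩ + χ (⟨Div τ, ∇ tr σ⟩ + ⟨∇ tr τ, Div σ⟩) dV`. -/
def stressForm {V : Set E3} (ν : ℝ) (τ σ : X0 V) : ℝ :=
  ∫ x in V, ((∑ i, ∑ j, ∑ k, tensorD τ x i j k * tensorD σ x i j k)
    + chi ν * ((∑ i, tensorDiv τ x i * gradTrace σ x i)
      + ∑ i, gradTrace τ x i * tensorDiv σ x i))

/-- The components of `sym Df` for a vector field `f ∈ H¹(V)³`. -/
def symGrad {V : Set E3} (f : Fin 3 → H1 V) (x : E3) (i j : Fin 3) : ℝ :=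
  (h1Deriv (f i) j x + h1Deriv (f j) i x) / 2

/-- The divergence `div f` of a vector field `f ∈ H¹(V)³`. -/
def vecDiv {V : Set E3} (f : Fin 3 → H1 V) (x : E3) : ℝ := ∑ i, h1Deriv (f i) i x

/-- The linear form of the body force `f`,
`l(τ) = ∫_V 2 ⟨τ, sym Df⟩ + (1 + ν²) / (1 - ν²) (tr τ) (div f) dV`. -/
def loadForm {V : Set E3} (ν : ℝ) (f : Fin 3 → H1 V) (τ : X0 V) : ℝ :=
  ∫ x in V, (2 * (∑ i, ∑ j, h1Fun (comp τ i j) x * symGrad f x i j)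
    + (1 + ν ^ 2) / (1 - ν ^ 2) * (h1Fun (trace τ) x * vecDiv f x))

end StressWellPosed

end

namespace StressWellPosed

/-! Everything except coercivity is soft: `X0 V` is complete, and Lax–Milgram gives existence,
uniqueness and the a priori bound. Coercivity is not pointwise. For `χ = 1` the integrand of `a(σ,
σ)`, a quadratic form in `G = Dσ`, takes negative values.

The remedy is a null Lagrangian. Since second derivatives commute, `∂ₖσᵢⱼ ∂ⱼσᵢₖ - ∂ⱼσᵢⱼ ∂ₖσᵢₖ`
integrates to zero on `H¹₀(V)` (`integral_h1Deriv_mul_comm`). Subtracting 3/4 of its sum over all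
indices leaves the integral unchanged and makes the integrand at least `|G|² / 10` for every `χ ∈
[0, 1]` (`gradient_form_coercive`). The Poincaré inequality (`poincare`) then recovers the full
norm.

The continuity constant comes from a pointwise bound on the quadratic form
(`two_mul_div_gradTrace_le`), passed to the bilinear form by polarization
(`abs_bilin_le_of_abs_self_le`). -/

/-! ### Pointwise algebra of gradient tensors -/

theorem odd_block_nonneg {c : ℝ} (h0 : 0 ≤ c) (h1 : c ≤ 1) (x y z s r : ℝ) :
    0 ≤ 9 / 10 * (x ^ 2 + y ^ 2 + z ^ 2 + 2 * s ^ 2 + 2 * r ^ 2)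
      + 2 * c * ((x + s + r) * (x + y + z))
      - 3 / 4 * (x ^ 2 + s ^ 2 + r ^ 2 + 2 * s * y + 2 * r * z - (x + s + r) ^ 2) := by
  -- In the variables `y ± z`, `s ± r` the differences decouple from `x` and the sums, and are free
  -- of `c`. The remaining form is affine in `c`, so the endpoints `c = 0` and `c = 1` suffice.
  have hd : 0 ≤ 9 / 20 * (y - z) ^ 2 - 3 / 4 * ((y - z) * (s - r)) + 21 / 40 * (s - r) ^ 2 := by
    nlinarith [sq_nonneg ((y - z) - 5 / 6 * (s - r)), sq_nonneg (s - r)]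
  have hs0 : ∀ m n : ℝ, 0 ≤ 9 / 10 * x ^ 2 + 9 / 20 * m ^ 2 + 51 / 40 * n ^ 2 - 3 / 4 * (m * n)
      + 3 / 2 * (x * n) := by
    intro m n
    nlinarith [sq_nonneg (x + 5 / 6 * n), sq_nonneg (m - 5 / 6 * n), sq_nonneg n]
  have hs1 : ∀ m n : ℝ, 0 ≤ 9 / 10 * x ^ 2 + 9 / 20 * m ^ 2 + 51 / 40 * n ^ 2 - 3 / 4 * (m * n)
      + 3 / 2 * (x * n) + 2 * ((x + n) * (x + m)) := by
    intro m n
    nlinarith [sq_nonneg (x + 10 / 29 * m + 35 / 58 * n), sq_nonneg (m + 5 / 24 * n),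
      sq_nonneg (m + 1 / 5 * n), sq_nonneg n]
  nlinarith [mul_nonneg (sub_nonneg.2 h1) (hs0 (y + z) (s + r)),
    mul_nonneg h0 (hs1 (y + z) (s + r))]

/-- The form is invariant under coordinate reflections, so it splits by the parity with which each
index occurs: one block of entries with three distinct indices, and for each axis a block of five
entries handled by `odd_block_nonneg`. The weight 3/4 is a compromise: weight 0 fails in the
five-entry blocks at `c = 1`, and a weight above 9/10 fails in the distinct-index block. -/
theorem gradient_form_coercive {c : ℝ} (h0 : 0 ≤ c) (h1 : c ≤ 1) (G : Fin 3 → Fin 3 → Fin 3 → ℝ)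
    (hG : ∀ i j k, G i j k = G j i k) :
    1 / 10 * ∑ i, ∑ j, ∑ k, G i j k * G i j k ≤
      (∑ i, ∑ j, ∑ k, G i j k * G i j k)
        + c * ((∑ i, (∑ j, G i j j) * ∑ j, G j j i) + ∑ i, (∑ j, G j j i) * ∑ j, G i j j)
        - 3 / 4 * ∑ i, ∑ j, ∑ k, (G i j k * G i k j - G i j j * G i k k) := by
  simp only [Fin.sum_univ_three, hG 1 0, hG 2 0, hG 2 1]
  -- The distinct-index block; its smallest eigenvalue is 9/5 - 3/2 = 3/10, on the diagonal
  -- direction.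
  have e : 0 ≤ 9 / 5 * (G 0 1 2 ^ 2 + G 0 2 1 ^ 2 + G 1 2 0 ^ 2)
      - 3 / 2 * (G 0 1 2 * G 0 2 1 + G 0 1 2 * G 1 2 0 + G 0 2 1 * G 1 2 0) := by
    nlinarith [sq_nonneg (G 0 1 2 - G 0 2 1), sq_nonneg (G 0 1 2 - G 1 2 0),
      sq_nonneg (G 0 2 1 - G 1 2 0), sq_nonneg (G 0 1 2), sq_nonneg (G 0 2 1), sq_nonneg (G 1 2 0)]
  linarith [odd_block_nonneg h0 h1 (G 0 0 0) (G 1 1 0) (G 2 2 0) (G 0 1 1) (G 0 2 2),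
    odd_block_nonneg h0 h1 (G 1 1 1) (G 0 0 1) (G 2 2 1) (G 0 1 0) (G 1 2 2),
    odd_block_nonneg h0 h1 (G 2 2 2) (G 0 0 2) (G 1 1 2) (G 0 2 0) (G 1 2 1)]

/-- Young's inequality `2uv ≤ u² + v²`, with Cauchy–Schwarz costing a factor 3 for each of the two
three-term sums, whence 6 = 3 + 3. -/
theorem two_mul_div_gradTrace_le (G : Fin 3 → Fin 3 → Fin 3 → ℝ) :
    |(∑ i, (∑ j, G i j j) * ∑ j, G j j i) + ∑ i, (∑ j, G j j i) * ∑ j, G i j j|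
      ≤ 6 * ∑ i, ∑ j, ∑ k, G i j k * G i j k := by
  have h3 : ∀ g : Fin 3 → ℝ, (∑ j, g j) ^ 2 ≤ 3 * ∑ j, g j * g j := by
    intro g
    simp only [Fin.sum_univ_three]
    nlinarith [sq_nonneg (g 0 - g 1), sq_nonneg (g 0 - g 2), sq_nonneg (g 1 - g 2)]
  have hle : ∑ i, ∑ j, G i j j * G i j j ≤ ∑ i, ∑ j, ∑ k, G i j k * G i j k :=
    Finset.sum_le_sum fun i _ => Finset.sum_le_sum fun j _ =>
      Finset.single_le_sum (f := fun k => G i j k * G i j k)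
        (fun k _ => mul_self_nonneg _) (Finset.mem_univ j)
  have hle' : ∑ i, ∑ j, G j j i * G j j i ≤ ∑ i, ∑ j, ∑ k, G i j k * G i j k := by
    rw [Finset.sum_comm]
    exact Finset.sum_le_sum fun i _ =>
      Finset.single_le_sum (f := fun j => ∑ k, G i j k * G i j k)
        (fun j _ => Finset.sum_nonneg fun k _ => mul_self_nonneg _) (Finset.mem_univ i)
  -- The sign `e = ±1` treats both halves of the absolute value at once.
  have key : ∀ e : ℝ, e ^ 2 = 1 →
      e * ((∑ i, (∑ j, G i j j) * ∑ j, G j j i) + ∑ i, (∑ j, G j j i) * ∑ j, G i j j)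
      ≤ ∑ i, (3 * (∑ j, G i j j * G i j j) + 3 * ∑ j, G j j i * G j j i) := by
    intro e he
    rw [← Finset.sum_add_distrib, Finset.mul_sum]
    refine Finset.sum_le_sum fun i _ => ?_
    nlinarith [h3 fun j => G i j j, h3 fun j => G j j i,
      sq_nonneg (e * (∑ j, G i j j) - ∑ j, G j j i)]
  rw [Finset.sum_add_distrib, ← Finset.mul_sum, ← Finset.mul_sum] at key
  rw [abs_le]
  constructor <;> linarith [key 1 (by norm_num), key (-1) (by norm_num)]

/-! ### Norms, closedness and completeness -/

variable {V : Set E3}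

theorem L2_inner_eq_integral (u v : L2 V) : inner ℝ u v = ∫ x in V, u x * v x := by
  rw [L2.inner_def]
  exact integral_congr_ae (.of_forall fun x => by simp [mul_comm])

theorem integrable_L2_mul_L2 (u v : L2 V) :
    Integrable (fun x => u x * v x) (volume.restrict V) :=
  MemLp.integrable_mul (p := 2) (q := 2) (Lp.memLp u) (Lp.memLp v)

theorem L2_norm_sq_eq_integral (u : L2 V) : ‖u‖ ^ 2 = ∫ x in V, u x * u x := by
  rw [← L2_inner_eq_integral, real_inner_self_eq_norm_sq]

theorem L2Pair.norm_sq (p : L2Pair V) : ‖p‖ ^ 2 = ‖p.fn‖ ^ 2 + ∑ k, ‖p.grad k‖ ^ 2 := by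
  have h := WithLp.prod_norm_sq_eq_of_L2
    (α := L2 V) (β := PiLp 2 (fun _ : Fin 3 => L2 V)) p
  rw [PiLp.norm_sq_eq_of_L2] at h
  exact h

theorem L2Pair.norm_fn_le (p : L2Pair V) : ‖p.fn‖ ≤ ‖p‖ := by
  refine le_of_sq_le_sq ?_ (norm_nonneg _)
  rw [L2Pair.norm_sq]
  exact le_add_of_nonneg_right (Finset.sum_nonneg fun k _ => sq_nonneg _)

theorem L2Pair.norm_grad_le (p : L2Pair V) (k : Fin 3) : ‖p.grad k‖ ≤ ‖p‖ := by
  refine le_of_sq_le_sq ?_ (norm_nonneg _)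
  rw [L2Pair.norm_sq]
  have := Finset.single_le_sum (f := fun k => ‖p.grad k‖ ^ 2) (fun k _ => sq_nonneg _)
    (Finset.mem_univ k)
  linarith [sq_nonneg ‖p.fn‖]

/-- The first entry of a pair, as a continuous linear map. -/
noncomputable def fnL (V : Set E3) : L2Pair V →L[ℝ] L2 V :=
  LinearMap.mkContinuous ⟨⟨L2Pair.fn, fun _ _ => rfl⟩, fun _ _ => rfl⟩ 1
    fun p => (one_mul ‖p‖).symm ▸ p.norm_fn_le

/-- The `k`-th gradient entry of a pair, as a continuous linear map. -/
noncomputable def gradL (V : Set E3) (k : Fin 3) : L2Pair V →L[ℝ] L2 V :=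
  LinearMap.mkContinuous ⟨⟨fun p => p.grad k, fun _ _ => rfl⟩, fun _ _ => rfl⟩ 1
    fun p => (one_mul ‖p‖).symm ▸ p.norm_grad_le k

theorem continuous_integral_mul {ψ : E3 → ℝ} (hc : Continuous ψ) (hs : HasCompactSupport ψ) :
    Continuous fun u : L2 V => ∫ x in V, u x * ψ x := by
  have hm : MemLp ψ 2 (volume.restrict V) := (hc.memLp_of_hasCompactSupport hs).restrict V
  have : (fun u : L2 V => ∫ x in V, u x * ψ x) = fun u => inner ℝ u hm.toLp := by
    funext u
    rw [L2_inner_eq_integral]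
    refine integral_congr_ae ?_
    filter_upwards [hm.coeFn_toLp] with x hx
    rw [hx]
  rw [this]
  fun_prop

/-- Each weak-derivative identity equates two continuous functionals of the pair, because test
functions and their derivatives lie in `L²`. -/
theorem isClosed_H1 : IsClosed (H1 V : Set (L2Pair V)) := by
  have : (H1 V : Set (L2Pair V)) = ⋂ (i : Fin 3) (φ : E3 → ℝ) (_ : IsTestFun V φ),
      {p | ∫ x in V, (fnL V p) x * partialDeriv i φ x = - ∫ x in V, (gradL V i p) x * φ x} := by
    ext p
    simp only [Set.mem_iInter]
    rfl
  rw [this]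
  refine isClosed_iInter fun i => isClosed_iInter fun φ => isClosed_iInter fun hφ => ?_
  exact isClosed_eq
    ((continuous_integral_mul (hφ.continuous_partialDeriv i)
      (hφ.compact_partialDeriv i)).comp (fnL V).continuous)
    ((continuous_integral_mul hφ.smooth.continuous hφ.compact).comp (gradL V i).continuous).neg

theorem isClosed_H10_map : IsClosed ((H10 V).map (H1 V).subtype : Set (L2Pair V)) := by
  rw [Submodule.map_coe]
  exact isClosed_H1.isClosedEmbedding_subtypeVal.isClosedMap _
    (testH1 V).isClosed_topologicalClosure

theorem isClosed_X0 : IsClosed (X0 V : Set (PiLp 2 (fun _ : Fin 3 × Fin 3 => L2Pair V))) := by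
  have : (X0 V : Set (PiLp 2 (fun _ : Fin 3 × Fin 3 => L2Pair V))) = ⋂ (i : Fin 3) (j : Fin 3),
      {σ | σ (i, j) ∈ ((H10 V).map (H1 V).subtype : Set (L2Pair V))} ∩
        {σ | σ (i, j) = σ (j, i)} := by
    ext σ
    simp only [Set.mem_iInter]
    rfl
  rw [this]
  have hc (p : Fin 3 × Fin 3) :
      Continuous fun σ : PiLp 2 (fun _ : Fin 3 × Fin 3 => L2Pair V) => σ p :=
    PiLp.continuous_apply 2 _ p
  exact isClosed_iInter fun i => isClosed_iInter fun j =>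
    (isClosed_H10_map.preimage (hc (i, j))).inter (isClosed_eq (hc (i, j)) (hc (j, i)))

instance : CompleteSpace (X0 V) := isClosed_X0.completeSpace_coe

/-! ### Test functions and null Lagrangians -/

theorem IsTestFun.partialDeriv {φ : E3 → ℝ} (hφ : IsTestFun V φ) (k : Fin 3) :
    IsTestFun V (partialDeriv k φ) where
  smooth := (hφ.smooth.fderiv_right (m := ∞) (by simp)).clm_apply contDiff_const
  compact := hφ.compact_partialDeriv k
  subset := (tsupport_fderiv_apply_subset ℝ (EuclideanSpace.single k 1)).trans hφ.subset

theorem partialDeriv_comm {φ : E3 → ℝ} (hφ : IsTestFun V φ) (k l : Fin 3) :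
    partialDeriv k (partialDeriv l φ) = partialDeriv l (partialDeriv k φ) := by
  have key : ∀ k l x, partialDeriv k (partialDeriv l φ) x =
      fderiv ℝ (fderiv ℝ φ) x (EuclideanSpace.single k 1) (EuclideanSpace.single l 1) := by
    intro k l x
    have hd : DifferentiableAt ℝ (fderiv ℝ φ) x :=
      ((hφ.smooth.fderiv_right (m := ∞) (by simp)).differentiable (by simp)).differentiableAt
    change fderiv ℝ (fun y => fderiv ℝ φ y (EuclideanSpace.single l 1)) x _ = _
    rw [fderiv_clm_apply hd (by fun_prop)]
    simp
  funext x
  rw [key, key]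
  exact (hφ.smooth.contDiffAt.isSymmSndFDerivAt (by
    rw [minSmoothness_of_isRCLikeNormedField]
    exact WithTop.coe_le_coe.2 (le_top (a := (2 : ℕ∞))))).eq _ _

theorem setIntegral_mul_partialDeriv {φ ψ : E3 → ℝ} (hφ : IsTestFun V φ) (hψ : IsTestFun V ψ)
    (k : Fin 3) :
    ∫ x in V, φ x * partialDeriv k ψ x = - ∫ x in V, partialDeriv k φ x * ψ x := by
  have supp : ∀ {η ζ : E3 → ℝ}, IsTestFun V ζ →
      ∫ x in V, η x * ζ x = ∫ x, η x * ζ x := by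
    intro η ζ hζ
    refine setIntegral_eq_integral_of_forall_compl_eq_zero fun x hx => ?_
    rw [image_eq_zero_of_notMem_tsupport fun h => hx (hζ.subset h), mul_zero]
  rw [supp (hψ.partialDeriv k), supp hψ]
  have int : ∀ {η ζ : E3 → ℝ}, IsTestFun V η → IsTestFun V ζ →
      Integrable (fun x => η x * ζ x) := fun hη hζ =>
    (hη.smooth.continuous.mul hζ.smooth.continuous).integrable_of_hasCompactSupport
      hη.compact.mul_right
  exact integral_mul_fderiv_eq_neg_fderiv_mul_of_integrable (int (hφ.partialDeriv k) hψ)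
    (int hφ (hψ.partialDeriv k)) (int hφ hψ)
    (fun x _ => (hφ.smooth.differentiable (by simp)).differentiableAt)
    (fun x _ => (hψ.smooth.differentiable (by simp)).differentiableAt)

/-- Membership in `testH1` constrains only the function part; uniqueness of weak derivatives on an
open set, by the fundamental lemma of the calculus of variations, also fixes the gradient part. -/
theorem h1Deriv_ae_eq_partialDeriv (hV : IsOpen V) {u : H1 V} {φ : E3 → ℝ} (hφ : IsTestFun V φ)
    (hu : h1Fun u =ᵐ[volume.restrict V] φ) (k : Fin 3) :
    h1Deriv u k =ᵐ[volume.restrict V] partialDeriv k φ := by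
  have hm : MemLp (partialDeriv k φ) 2 (volume.restrict V) :=
    (((hφ.continuous_partialDeriv k).memLp_of_hasCompactSupport
      (hφ.compact_partialDeriv k))).restrict V
  have hml : MemLp (h1Deriv u k - partialDeriv k φ) 2 (volume.restrict V) :=
    (Lp.memLp _).sub hm
  have hloc : LocallyIntegrableOn (h1Deriv u k - partialDeriv k φ) V volume :=
    locallyIntegrableOn_of_locallyIntegrable_restrict (hml.locallyIntegrable (by norm_num))
  have h0 := hV.ae_eq_zero_of_integral_contDiff_smul_eq_zero hloc ?_
  · rw [Filter.EventuallyEq, ae_restrict_iff' hV.measurableSet]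
    filter_upwards [h0] with x hx hxV
    exact sub_eq_zero.1 (hx hxV)
  intro g hg hgc hgs
  have ht : IsTestFun V g := ⟨hg, hgc, hgs⟩
  rw [← setIntegral_eq_integral_of_forall_compl_eq_zero (s := V) (fun x hx => by
    rw [image_eq_zero_of_notMem_tsupport fun h => hx (hgs h), zero_smul])]
  have e1 : ∫ x in V, h1Fun u x * partialDeriv k g x = - ∫ x in V, h1Deriv u k x * g x :=
    u.2 k g ht
  have e2 : ∫ x in V, h1Fun u x * partialDeriv k g x = ∫ x in V, φ x * partialDeriv k g x := by
    refine integral_congr_ae ?_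
    filter_upwards [hu] with x hx
    rw [hx]
  rw [e2, setIntegral_mul_partialDeriv hφ ht, neg_inj] at e1
  have e3 : ∀ x, g x • (h1Deriv u k - partialDeriv k φ) x
      = h1Deriv u k x * g x - partialDeriv k φ x * g x := by
    intro x; simp only [Pi.sub_apply, smul_eq_mul]; ring
  simp_rw [e3]
  have i1 : Integrable (fun x => h1Deriv u k x * g x) (volume.restrict V) :=
    integrable_L2_mul _ hg.continuous hgc
  rw [integral_sub i1, e1, sub_self]
  exact (((hφ.continuous_partialDeriv k).mul hg.continuous).integrable_of_hasCompactSupport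
    hgc.mul_left).restrict

/-- Density: a closed condition on `H10 V` need only be checked on test functions. -/
theorem H10_induction {p : H1 V → Prop} (hcl : IsClosed {u | p u})
    (h : ∀ u φ, IsTestFun V φ → h1Fun u =ᵐ[volume.restrict V] φ → p u) {u : H1 V}
    (hu : u ∈ H10 V) : p u :=
  closure_minimal (s := (testH1 V : Set (H1 V))) (t := {u | p u})
    (by rintro v ⟨φ, hφ, hv⟩; exact h v φ hφ hv) hcl hu

/-- The expressions `∂ₖu ∂ₗw - ∂ₗu ∂ₖw` are null Lagrangians on `H¹₀(V)`. -/
theorem integral_h1Deriv_mul_comm (hV : IsOpen V) {u : H1 V} (hu : u ∈ H10 V) (w : H1 V)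
    (k l : Fin 3) :
    ∫ x in V, h1Deriv u k x * h1Deriv w l x = ∫ x in V, h1Deriv u l x * h1Deriv w k x := by
  refine H10_induction (p := fun u => ∫ x in V, h1Deriv u k x * h1Deriv w l x
    = ∫ x in V, h1Deriv u l x * h1Deriv w k x) ?_ ?_ hu
  · have e : ∀ k l, (fun u : H1 V => ∫ x in V, h1Deriv u k x * h1Deriv w l x)
        = fun u : H1 V => inner ℝ (gradL V k u) (gradL V l w) :=
      fun k l => funext fun u => (L2_inner_eq_integral _ _).symm
    have hc : ∀ k l, Continuous fun u : H1 V => ∫ x in V, h1Deriv u k x * h1Deriv w l x := by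
      intro k l
      rw [e]
      fun_prop
    exact isClosed_eq (hc k l) (hc l k)
  · intro u φ hφ hu
    -- The derivative `∂ₖφ` is itself a test function for `w`, so `w` needs no boundary condition;
    -- the result is symmetric in `k` and `l`.
    have e : ∀ k l, ∫ x in V, h1Deriv u k x * h1Deriv w l x
        = - ∫ x in V, h1Fun w x * partialDeriv l (partialDeriv k φ) x := by
      intro k l
      rw [show ∫ x in V, h1Fun w x * partialDeriv l (partialDeriv k φ) x
        = - ∫ x in V, h1Deriv w l x * partialDeriv k φ x from w.2 l _ (hφ.partialDeriv k), neg_neg]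
      refine integral_congr_ae ?_
      filter_upwards [h1Deriv_ae_eq_partialDeriv hV hφ hu k] with x hx
      rw [hx, mul_comm]
    rw [e k l, e l k, partialDeriv_comm hφ]

/-! ### The Poincaré inequality -/

theorem IsTestFun.coord_mul {φ : E3 → ℝ} (hφ : IsTestFun V φ) (k : Fin 3) :
    IsTestFun V (fun x => x k * φ x) where
  smooth := (contDiff_piLp_apply (p := 2)).mul hφ.smooth
  compact := hφ.compact.mul_left
  subset := (tsupport_mul_subset_right).trans hφ.subset

theorem partialDeriv_coord_mul {φ : E3 → ℝ} (hφ : IsTestFun V φ) (k : Fin 3) (x : E3) :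
    partialDeriv k (fun x => x k * φ x) x = φ x + x k * partialDeriv k φ x := by
  have h1 : HasFDerivAt (fun x : E3 => x k) (EuclideanSpace.proj k : E3 →L[ℝ] ℝ) x :=
    (EuclideanSpace.proj k : E3 →L[ℝ] ℝ).hasFDerivAt
  have h2 := (hφ.smooth.differentiable (by simp)).differentiableAt (x := x) |>.hasFDerivAt
  simp only [partialDeriv]
  rw [HasFDerivAt.fderiv (f := fun x : E3 => x k * φ x) (h1.mul h2)]
  simp [add_comm]

/-- The Poincaré inequality on `H¹₀(V)` for `V` contained in a ball. -/
theorem poincare (hV : IsOpen V) {R : ℝ} (hR : ∀ x ∈ V, ‖x‖ ≤ R) {u : H1 V} (hu : u ∈ H10 V)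
    (k : Fin 3) :
    ‖(u : L2Pair V).fn‖ ^ 2 ≤ 4 * R ^ 2 * ‖(u : L2Pair V).grad k‖ ^ 2 := by
  refine H10_induction (p := fun u : H1 V => ‖(u : L2Pair V).fn‖ ^ 2
    ≤ 4 * R ^ 2 * ‖(u : L2Pair V).grad k‖ ^ 2) ?_ ?_ hu
  · have h1 : Continuous fun u : H1 V => (u : L2Pair V).fn :=
      (fnL V).continuous.comp continuous_subtype_val
    have h2 : Continuous fun u : H1 V => (u : L2Pair V).grad k :=
      (gradL V k).continuous.comp continuous_subtype_val
    exact isClosed_le (h1.norm.pow 2) ((h2.norm.pow 2).const_mul _)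
  intro u φ hφ hu
  have hd := h1Deriv_ae_eq_partialDeriv hV hφ hu k
  rw [L2_norm_sq_eq_integral, L2_norm_sq_eq_integral]
  change ∫ x in V, h1Fun u x * h1Fun u x ≤ 4 * R ^ 2 * ∫ x in V, h1Deriv u k x * h1Deriv u k x
  -- Testing with `xₖφ` gives `∫ φ² = -∫ 2 xₖ φ ∂ₖφ`.
  have e0 : ∫ x in V, h1Fun u x * partialDeriv k (fun x => x k * φ x) x
      = - ∫ x in V, h1Deriv u k x * (x k * φ x) := u.2 k _ (hφ.coord_mul k)
  have i1 : Integrable (fun x => h1Fun u x * partialDeriv k (fun x => x k * φ x) x)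
      (volume.restrict V) := integrable_L2_mul _ ((hφ.coord_mul k).continuous_partialDeriv k)
        ((hφ.coord_mul k).compact_partialDeriv k)
  have i2 : Integrable (fun x => h1Deriv u k x * (x k * φ x)) (volume.restrict V) :=
    integrable_L2_mul _ (hφ.coord_mul k).smooth.continuous (hφ.coord_mul k).compact
  have i3 : Integrable (fun x => h1Fun u x * h1Fun u x) (volume.restrict V) :=
    integrable_L2_mul_L2 _ _
  have i4 : Integrable (fun x => h1Deriv u k x * h1Deriv u k x) (volume.restrict V) :=
    integrable_L2_mul_L2 _ _
  have i12 : Integrable (fun x => h1Fun u x * partialDeriv k (fun x => x k * φ x) x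
      + h1Deriv u k x * (x k * φ x)) (volume.restrict V) := i1.add i2
  -- The left integrand equals `-2 xₖ φ ∂ₖφ`, which Young's inequality bounds by `φ²/2 + 2R²
  -- (∂ₖφ)²`; absorbing the first term yields the factor `4R²`.
  have hle : ∫ x in V, (h1Fun u x * h1Fun u x
        - (h1Fun u x * partialDeriv k (fun x => x k * φ x) x + h1Deriv u k x * (x k * φ x)))
      ≤ ∫ x in V, (1 / 2 * (h1Fun u x * h1Fun u x)
        + 2 * R ^ 2 * (h1Deriv u k x * h1Deriv u k x)) := by
    refine integral_mono_ae (i3.sub i12) ((i3.const_mul _).add (i4.const_mul _)) ?_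
    filter_upwards [hu, hd, ae_restrict_mem hV.measurableSet] with x hx hdx hxV
    have hxk : (x k) ^ 2 ≤ R ^ 2 := by
      rw [← sq_abs]
      exact pow_le_pow_left₀ (abs_nonneg _) ((PiLp.norm_apply_le x k).trans (hR x hxV)) 2
    rw [partialDeriv_coord_mul hφ, hx, hdx]
    nlinarith [sq_nonneg (φ x + 2 * (x k * partialDeriv k φ x)),
      mul_le_mul_of_nonneg_right hxk (sq_nonneg (partialDeriv k φ x))]
  rw [integral_sub i3 i12, integral_add i1 i2,
    integral_add (i3.const_mul _) (i4.const_mul _), integral_const_mul, integral_const_mul,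
    e0] at hle
  linarith

/-! ### The stress form as an integral over gradient tensors -/

/-- The integrand of the stress form as a bilinear form in the gradient tensors. -/
def gradForm (c : ℝ) (G H : Fin 3 → Fin 3 → Fin 3 → ℝ) : ℝ :=
  (∑ i, ∑ j, ∑ k, G i j k * H i j k)
    + c * ((∑ i, (∑ j, G i j j) * ∑ j, H j j i) + ∑ i, (∑ j, G j j i) * ∑ j, H i j j)

theorem gradForm_symm (c : ℝ) (G H : Fin 3 → Fin 3 → Fin 3 → ℝ) :
    gradForm c G H = gradForm c H G := by
  simp only [gradForm, mul_comm (G _ _ _), mul_comm (∑ j, G _ j _)]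
  ring

theorem gradForm_add_left (c : ℝ) (G G' H : Fin 3 → Fin 3 → Fin 3 → ℝ) :
    gradForm c (G + G') H = gradForm c G H + gradForm c G' H := by
  simp only [gradForm, Pi.add_apply, add_mul, Finset.sum_add_distrib]
  ring

theorem gradForm_smul_left (c r : ℝ) (G H : Fin 3 → Fin 3 → Fin 3 → ℝ) :
    gradForm c (r • G) H = r * gradForm c G H := by
  simp only [gradForm, Pi.smul_apply, smul_eq_mul, mul_add, Finset.mul_sum, Finset.sum_mul,
    mul_assoc, mul_left_comm c r]

theorem abs_gradForm_self_le {c : ℝ} (hc : 0 ≤ c) (G : Fin 3 → Fin 3 → Fin 3 → ℝ) :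
    |gradForm c G G| ≤ (1 + 6 * c) * ∑ i, ∑ j, ∑ k, G i j k * G i j k := by
  have h0 : 0 ≤ ∑ i, ∑ j, ∑ k, G i j k * G i j k :=
    Finset.sum_nonneg fun i _ => Finset.sum_nonneg fun j _ => Finset.sum_nonneg fun k _ =>
      mul_self_nonneg _
  refine (abs_add_le _ _).trans ?_
  rw [abs_of_nonneg h0, abs_mul, abs_of_nonneg hc]
  linarith [mul_le_mul_of_nonneg_left (two_mul_div_gradTrace_le G) hc]

theorem integrable_tensorD_mul (τ σ : X0 V) (i j k i' j' k' : Fin 3) :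
    Integrable (fun x => tensorD τ x i j k * tensorD σ x i' j' k') (volume.restrict V) :=
  integrable_L2_mul_L2 _ _

theorem tensorD_symm (σ : X0 V) (x : E3) (i j k : Fin 3) :
    tensorD σ x i j k = tensorD σ x j i k := by
  have : comp σ i j = comp σ j i := Subtype.ext (σ.2 i j).2
  rw [tensorD, tensorD, this]

theorem h1Fun_add (u v : H1 V) : h1Fun (u + v) =ᵐ[volume.restrict V] h1Fun u + h1Fun v :=
  Lp.coeFn_add _ _

theorem h1Deriv_add (u v : H1 V) (k : Fin 3) :
    h1Deriv (u + v) k =ᵐ[volume.restrict V] h1Deriv u k + h1Deriv v k :=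
  Lp.coeFn_add _ _

theorem h1Deriv_smul (c : ℝ) (u : H1 V) (k : Fin 3) :
    h1Deriv (c • u) k =ᵐ[volume.restrict V] c • h1Deriv u k :=
  Lp.coeFn_smul _ _

theorem tensorD_add (τ σ : X0 V) :
    ∀ᵐ x ∂volume.restrict V, tensorD (τ + σ) x = tensorD τ x + tensorD σ x := by
  have h : ∀ᵐ x ∂volume.restrict V, ∀ i j k,
      tensorD (τ + σ) x i j k = tensorD τ x i j k + tensorD σ x i j k := by
    simp only [ae_all_iff]
    exact fun i j k => h1Deriv_add (comp τ i j) (comp σ i j) k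
  filter_upwards [h] with x hx
  ext i j k
  exact hx i j k

theorem tensorD_smul (c : ℝ) (σ : X0 V) :
    ∀ᵐ x ∂volume.restrict V, tensorD (c • σ) x = c • tensorD σ x := by
  have h : ∀ᵐ x ∂volume.restrict V, ∀ i j k,
      tensorD (c • σ) x i j k = c * tensorD σ x i j k := by
    simp only [ae_all_iff]
    exact fun i j k => h1Deriv_smul c (comp σ i j) k
  filter_upwards [h] with x hx
  ext i j k
  exact hx i j k

/-- The trace is summed in `H1 V`, hence as `L²` classes, so the pointwise formula holds only almost
everywhere. -/
theorem gradTrace_ae (σ : X0 V) :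
    ∀ᵐ x ∂volume.restrict V, ∀ k, gradTrace σ x k = ∑ j, tensorD σ x j j k := by
  rw [ae_all_iff]
  intro k
  have e : trace σ = comp σ 0 0 + comp σ 1 1 + comp σ 2 2 := Fin.sum_univ_three _
  filter_upwards [h1Deriv_add (comp σ 0 0 + comp σ 1 1) (comp σ 2 2) k,
    h1Deriv_add (comp σ 0 0) (comp σ 1 1) k] with x h1 h2
  rw [gradTrace, e, h1, Pi.add_apply, h2, Fin.sum_univ_three]
  rfl

theorem h1Fun_trace_ae (σ : X0 V) :
    ∀ᵐ x ∂volume.restrict V, h1Fun (trace σ) x = ∑ j, h1Fun (comp σ j j) x := by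
  have e : trace σ = comp σ 0 0 + comp σ 1 1 + comp σ 2 2 := Fin.sum_univ_three _
  filter_upwards [h1Fun_add (comp σ 0 0 + comp σ 1 1) (comp σ 2 2),
    h1Fun_add (comp σ 0 0) (comp σ 1 1)] with x h1 h2
  rw [e, h1, Pi.add_apply, h2, Fin.sum_univ_three]
  rfl

theorem stressForm_eq (ν : ℝ) (τ σ : X0 V) :
    stressForm ν τ σ = ∫ x in V, gradForm (chi ν) (tensorD τ x) (tensorD σ x) := by
  refine integral_congr_ae ?_
  filter_upwards [gradTrace_ae τ, gradTrace_ae σ] with x h1 h2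
  simp only [h1, h2]
  rfl

theorem integrable_gradForm (c : ℝ) (τ σ : X0 V) :
    Integrable (fun x => gradForm c (tensorD τ x) (tensorD σ x)) (volume.restrict V) := by
  simp only [gradForm, Finset.sum_mul_sum]
  have h := integrable_tensorD_mul τ σ
  exact (integrable_finsetSum _ fun i _ => integrable_finsetSum _ fun j _ =>
    integrable_finsetSum _ fun k _ => h _ _ _ _ _ _).add
    (((integrable_finsetSum _ fun i _ => integrable_finsetSum _ fun j _ =>
      integrable_finsetSum _ fun k _ => h _ _ _ _ _ _).add
    (integrable_finsetSum _ fun i _ => integrable_finsetSum _ fun j _ =>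
      integrable_finsetSum _ fun k _ => h _ _ _ _ _ _)).const_mul c)

theorem integrable_normSq_tensorD (σ : X0 V) :
    Integrable (fun x => ∑ i, ∑ j, ∑ k, tensorD σ x i j k * tensorD σ x i j k)
      (volume.restrict V) :=
  integrable_finsetSum _ fun _ _ => integrable_finsetSum _ fun _ _ =>
    integrable_finsetSum _ fun _ _ => integrable_tensorD_mul σ σ _ _ _ _ _ _

theorem integral_normSq_tensorD (σ : X0 V) :
    ∫ x in V, ∑ i, ∑ j, ∑ k, tensorD σ x i j k * tensorD σ x i j k
      = ∑ i, ∑ j, ∑ k, ‖(comp σ i j : L2Pair V).grad k‖ ^ 2 := by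
  have h := integrable_tensorD_mul σ σ
  rw [integral_finsetSum _ fun i _ => integrable_finsetSum _ fun j _ =>
    integrable_finsetSum _ fun k _ => h _ _ _ _ _ _]
  refine Finset.sum_congr rfl fun i _ => ?_
  rw [integral_finsetSum _ fun j _ => integrable_finsetSum _ fun k _ => h _ _ _ _ _ _]
  refine Finset.sum_congr rfl fun j _ => ?_
  rw [integral_finsetSum _ fun k _ => h _ _ _ _ _ _]
  exact Finset.sum_congr rfl fun k _ => (L2_norm_sq_eq_integral _).symm

theorem X0_norm_sq (σ : X0 V) :
    ‖σ‖ ^ 2 = (∑ i, ∑ j, ‖(comp σ i j : L2Pair V).fn‖ ^ 2)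
      + ∑ i, ∑ j, ∑ k, ‖(comp σ i j : L2Pair V).grad k‖ ^ 2 := by
  rw [Submodule.coe_norm, PiLp.norm_sq_eq_of_L2, Fintype.sum_prod_type,
    ← Finset.sum_add_distrib]
  refine Finset.sum_congr rfl fun i _ => ?_
  rw [← Finset.sum_add_distrib]
  exact Finset.sum_congr rfl fun j _ => L2Pair.norm_sq _

theorem comp_mem_H10 (σ : X0 V) (i j : Fin 3) : comp σ i j ∈ H10 V := by
  obtain ⟨u, hu, h⟩ := (σ.2 i j).1
  have : u = comp σ i j := Subtype.ext h
  exact this ▸ hu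

/-! ### Coercivity -/

theorem integral_tensorD_nullLagrangian (hV : IsOpen V) (σ : X0 V) :
    Integrable (fun x => ∑ i, ∑ j, ∑ k, (tensorD σ x i j k * tensorD σ x i k j
      - tensorD σ x i j j * tensorD σ x i k k)) (volume.restrict V) ∧
    ∫ x in V, ∑ i, ∑ j, ∑ k, (tensorD σ x i j k * tensorD σ x i k j
      - tensorD σ x i j j * tensorD σ x i k k) = 0 := by
  have h := integrable_tensorD_mul σ σ
  have h' : ∀ i j k, Integrable (fun x => tensorD σ x i j k * tensorD σ x i k j
      - tensorD σ x i j j * tensorD σ x i k k) (volume.restrict V) :=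
    fun i j k => (h _ _ _ _ _ _).sub (h _ _ _ _ _ _)
  refine ⟨integrable_finsetSum _ fun i _ => integrable_finsetSum _ fun j _ =>
    integrable_finsetSum _ fun k _ => h' i j k, ?_⟩
  rw [integral_finsetSum _ fun i _ => integrable_finsetSum _ fun j _ =>
    integrable_finsetSum _ fun k _ => h' i j k]
  refine Finset.sum_eq_zero fun i _ => ?_
  rw [integral_finsetSum _ fun j _ => integrable_finsetSum _ fun k _ => h' i j k]
  refine Finset.sum_eq_zero fun j _ => ?_
  rw [integral_finsetSum _ fun k _ => h' i j k]
  refine Finset.sum_eq_zero fun k _ => ?_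
  rw [integral_sub (h _ _ _ _ _ _) (h _ _ _ _ _ _), sub_eq_zero]
  exact integral_h1Deriv_mul_comm hV (comp_mem_H10 σ i j) (comp σ i k) k j

theorem stressForm_self_ge (hV : IsOpen V) {ν : ℝ} (h0 : 0 ≤ chi ν) (h1 : chi ν ≤ 1)
    (σ : X0 V) :
    1 / 10 * ∑ i, ∑ j, ∑ k, ‖(comp σ i j : L2Pair V).grad k‖ ^ 2 ≤ stressForm ν σ σ := by
  obtain ⟨hi, hz⟩ := integral_tensorD_nullLagrangian hV σ
  have hle := integral_mono ((integrable_normSq_tensorD σ).const_mul (1 / 10))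
    ((integrable_gradForm (chi ν) σ σ).sub (hi.const_mul (3 / 4)))
    fun x => gradient_form_coercive h0 h1 (tensorD σ x) (tensorD_symm σ x)
  rw [integral_const_mul, integral_normSq_tensorD] at hle
  rw [stressForm_eq]
  refine hle.trans_eq ?_
  rw [integral_sub' (integrable_gradForm (chi ν) σ σ) (hi.const_mul (3 / 4)),
    integral_const_mul, hz, mul_zero, sub_zero]

theorem stressForm_coercive (hV : IsOpen V) {R : ℝ} (hR : ∀ x ∈ V, ‖x‖ ≤ R) {ν : ℝ}
    (h0 : 0 ≤ chi ν) (h1 : chi ν ≤ 1) (σ : X0 V) :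
    1 / (10 * (1 + 4 * R ^ 2)) * ‖σ‖ ^ 2 ≤ stressForm ν σ σ := by
  refine le_trans ?_ (stressForm_self_ge hV h0 h1 σ)
  -- Poincaré in the single direction 0 suffices. It gives `‖σ‖² ≤ (1 + 4R²) ‖Dσ‖²`, hence the
  -- constant.
  have hp : ∑ i, ∑ j, ‖(comp σ i j : L2Pair V).fn‖ ^ 2
      ≤ 4 * R ^ 2 * ∑ i, ∑ j, ∑ k, ‖(comp σ i j : L2Pair V).grad k‖ ^ 2 := by
    rw [Finset.mul_sum]
    refine Finset.sum_le_sum fun i _ => ?_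
    rw [Finset.mul_sum]
    refine Finset.sum_le_sum fun j _ => (poincare hV hR (comp_mem_H10 σ i j) 0).trans ?_
    exact mul_le_mul_of_nonneg_left (Finset.single_le_sum
      (f := fun k => ‖(comp σ i j : L2Pair V).grad k‖ ^ 2) (fun k _ => sq_nonneg _)
      (Finset.mem_univ 0)) (by positivity)
  rw [X0_norm_sq, div_mul_eq_mul_div, one_mul, div_le_iff₀ (by positivity)]
  linarith

/-! ### Bilinearity and continuity -/

theorem stressForm_symm (ν : ℝ) (τ σ : X0 V) : stressForm ν τ σ = stressForm ν σ τ := by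
  simp only [stressForm_eq, gradForm_symm _ (tensorD τ _)]

theorem stressForm_add_left (ν : ℝ) (τ τ' σ : X0 V) :
    stressForm ν (τ + τ') σ = stressForm ν τ σ + stressForm ν τ' σ := by
  simp only [stressForm_eq]
  rw [← integral_add (integrable_gradForm _ _ _) (integrable_gradForm _ _ _)]
  refine integral_congr_ae ?_
  filter_upwards [tensorD_add τ τ'] with x hx
  rw [hx, gradForm_add_left]

theorem stressForm_smul_left (ν c : ℝ) (τ σ : X0 V) :
    stressForm ν (c • τ) σ = c * stressForm ν τ σ := by
  simp only [stressForm_eq]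
  rw [← integral_const_mul]
  refine integral_congr_ae ?_
  filter_upwards [tensorD_smul c τ] with x hx
  rw [hx, gradForm_smul_left]

theorem abs_stressForm_self_le {ν : ℝ} (h0 : 0 ≤ chi ν) (σ : X0 V) :
    |stressForm ν σ σ| ≤ (1 + 6 * chi ν) * ‖σ‖ ^ 2 := by
  rw [stressForm_eq, X0_norm_sq, ← integral_normSq_tensorD]
  have hle := abs_integral_le_integral_abs.trans <|
    integral_mono (integrable_gradForm (chi ν) σ σ).abs
    ((integrable_normSq_tensorD σ).const_mul (1 + 6 * chi ν))
    fun x => abs_gradForm_self_le h0 (tensorD σ x)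
  rw [integral_const_mul] at hle
  refine hle.trans (mul_le_mul_of_nonneg_left (le_add_of_nonneg_left ?_) (by positivity))
  positivity

/-- The stress form as an algebraic bilinear form. -/
noncomputable def stressBilin (V : Set E3) (ν : ℝ) : X0 V →ₗ[ℝ] X0 V →ₗ[ℝ] ℝ :=
  LinearMap.mk₂ ℝ (stressForm ν) (stressForm_add_left ν) (stressForm_smul_left ν)
    (fun τ σ σ' => by
      rw [stressForm_symm, stressForm_add_left, stressForm_symm ν σ, stressForm_symm ν σ'])
    (fun c τ σ => by rw [stressForm_symm, stressForm_smul_left, stressForm_symm, smul_eq_mul])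

/-- A symmetric bilinear form is bounded by any bound for its quadratic form. -/
theorem abs_bilin_le_of_abs_self_le {E : Type*} [NormedAddCommGroup E] [InnerProductSpace ℝ E]
    (B : E →ₗ[ℝ] E →ₗ[ℝ] ℝ) (hB : ∀ x y, B x y = B y x) {C : ℝ}
    (hC : ∀ x, |B x x| ≤ C * ‖x‖ ^ 2) (x y : E) : |B x y| ≤ C * ‖x‖ * ‖y‖ := by
  rcases eq_or_ne x 0 with rfl | hx
  · simp
  rcases eq_or_ne y 0 with rfl | hy
  · simp
  have hx' : 0 < ‖x‖ := norm_pos_iff.2 hx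
  have hy' : 0 < ‖y‖ := norm_pos_iff.2 hy
  have hn : ‖‖y‖ • x‖ = ‖x‖ * ‖y‖ ∧ ‖‖x‖ • y‖ = ‖x‖ * ‖y‖ := by
    simp [norm_smul, mul_comm]
  -- Rescaling both vectors to the common length `‖x‖ * ‖y‖` before polarizing makes the
  -- parallelogram law return the constant `C` without loss.
  have h1 := abs_le.1 (hC (‖y‖ • x + ‖x‖ • y))
  have h2 := abs_le.1 (hC (‖y‖ • x - ‖x‖ • y))
  have hpar := parallelogram_law_with_norm ℝ (‖y‖ • x) (‖x‖ • y)
  rw [hn.1, hn.2] at hpar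
  have hpol : B (‖y‖ • x + ‖x‖ • y) (‖y‖ • x + ‖x‖ • y)
      - B (‖y‖ • x - ‖x‖ • y) (‖y‖ • x - ‖x‖ • y) = 4 * (‖x‖ * ‖y‖) * B x y := by
    simp only [map_add, map_sub, map_smul, LinearMap.add_apply, LinearMap.sub_apply,
      LinearMap.smul_apply, smul_eq_mul, hB y x]
    ring
  have hsum : C * ‖‖y‖ • x + ‖x‖ • y‖ ^ 2 + C * ‖‖y‖ • x - ‖x‖ • y‖ ^ 2
      = 4 * (‖x‖ * ‖y‖) * (C * ‖x‖ * ‖y‖) := by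
    linear_combination C * hpar
  have hpos : 0 < 4 * (‖x‖ * ‖y‖) := by positivity
  rw [abs_le]
  constructor
  · refine le_of_mul_le_mul_left ?_ hpos
    linarith [h1.1, h2.2]
  · refine le_of_mul_le_mul_left ?_ hpos
    linarith [h1.2, h2.1]

theorem abs_stressForm_le {ν : ℝ} (h0 : 0 ≤ chi ν) (τ σ : X0 V) :
    |stressForm ν τ σ| ≤ (1 + 6 * chi ν) * ‖τ‖ * ‖σ‖ :=
  abs_bilin_le_of_abs_self_le (stressBilin V ν) (stressForm_symm ν)
    (abs_stressForm_self_le h0) τ σ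

/-! ### Well-posedness and the load form -/

/-- The Lax–Milgram theorem with the a priori bound, for a coercive bilinear form. -/
theorem lax_milgram {E : Type*} [NormedAddCommGroup E] [InnerProductSpace ℝ E] [CompleteSpace E]
    (a : E →L[ℝ] E →L[ℝ] ℝ) (hs : ∀ x y, a x y = a y x) {β : ℝ} (hβ : 0 < β)
    (hc : ∀ x, β * ‖x‖ ^ 2 ≤ a x x) (l : E →L[ℝ] ℝ) :
    (∃! x, ∀ y, a y x = l y) ∧ ∀ x, (∀ y, a y x = l y) → ‖x‖ ≤ 1 / β * ‖l‖ := by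
  have hco : IsCoercive a := ⟨β, hβ, fun x => by rw [mul_assoc, ← sq]; exact hc x⟩
  -- Stated for every functional `m`: the case `m = 0`, applied to a difference of solutions, gives
  -- uniqueness.
  have hbound : ∀ (m : E →L[ℝ] ℝ) x, (∀ y, a y x = m y) → ‖x‖ ≤ 1 / β * ‖m‖ := by
    intro m x hx
    rcases eq_or_ne x 0 with rfl | h
    · rw [norm_zero]; positivity
    have hx' : 0 < ‖x‖ := norm_pos_iff.2 h
    have h1 : β * ‖x‖ ^ 2 ≤ ‖m‖ * ‖x‖ :=
      (hc x).trans ((hx x).le.trans ((le_abs_self _).trans (m.le_opNorm x)))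
    rw [div_mul_eq_mul_div, one_mul, le_div_iff₀ hβ]
    refine le_of_mul_le_mul_right ?_ hx'
    linarith
  refine ⟨?_, hbound l⟩
  let f := (InnerProductSpace.toDual ℝ E).symm l
  let x := hco.continuousLinearEquivOfBilin.symm f
  have hx : ∀ y, a y x = l y := by
    intro y
    have h := hco.continuousLinearEquivOfBilin_apply x y
    rw [ContinuousLinearEquiv.apply_symm_apply, InnerProductSpace.toDual_symm_apply] at h
    rw [hs, ← h]
  refine ⟨x, hx, fun z hz => ?_⟩
  have h0 := hbound 0 (z - x) fun y => by simp [hz y, hx y]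
  rw [norm_zero, mul_zero] at h0
  exact sub_eq_zero.1 (norm_le_zero_iff.1 h0)

/-- The function part of the component `σᵢⱼ`, as a continuous linear map of `σ`. -/
noncomputable def compFnL (V : Set E3) (i j : Fin 3) : X0 V →L[ℝ] L2 V :=
  (fnL V).comp ((PiLp.proj 2 (fun _ : Fin 3 × Fin 3 => L2Pair V) (i, j)).comp (X0 V).subtypeL)

/-- The load is a finite combination of `L²` inner products of components of `τ` with the fixed
functions `∂ⱼfᵢ`, hence continuous. The factor 2 cancels the 1/2 in `sym Df`. -/
theorem exists_clm_eq_loadForm (ν : ℝ) (f : Fin 3 → H1 V) :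
    ∃ l : X0 V →L[ℝ] ℝ, ∀ τ, l τ = loadForm ν f τ := by
  let g : Fin 3 → Fin 3 → L2 V := fun i j => (f i : L2Pair V).grad j
  let c := (1 + ν ^ 2) / (1 - ν ^ 2)
  refine ⟨(∑ i, ∑ j, ((innerSL ℝ (g i j)).comp (compFnL V i j)
      + (innerSL ℝ (g j i)).comp (compFnL V i j)))
    + c • ∑ i, ∑ j, (innerSL ℝ (g j j)).comp (compFnL V i i), fun τ => ?_⟩
  have hI : ∀ i j i' j', Integrable (fun x => g i j x * (comp τ i' j' : L2Pair V).fn x)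
      (volume.restrict V) := fun i j i' j' => integrable_L2_mul_L2 _ _
  have e : ∀ i j i' j', innerSL ℝ (g i j) (compFnL V i' j' τ)
      = ∫ x in V, g i j x * (comp τ i' j' : L2Pair V).fn x :=
    fun i j i' j' => L2_inner_eq_integral _ _
  have hrhs : loadForm ν f τ = ∫ x in V, ((∑ i, ∑ j, (g i j x * (comp τ i j : L2Pair V).fn x
      + g j i x * (comp τ i j : L2Pair V).fn x))
      + c * ∑ i, ∑ j, g j j x * (comp τ i i : L2Pair V).fn x) := by
    refine integral_congr_ae ?_
    filter_upwards [h1Fun_trace_ae τ] with x hx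
    simp only [hx, symGrad, vecDiv, Finset.sum_mul_sum (f := fun j => h1Fun (comp τ j j) x)]
    rw [Finset.mul_sum]
    simp only [Finset.mul_sum (a := (2 : ℝ))]
    congr 1
    · exact Finset.sum_congr rfl fun i _ => Finset.sum_congr rfl fun j _ => by
        simp only [h1Fun, h1Deriv, g]; ring
    · congr 1
      exact Finset.sum_congr rfl fun i _ => Finset.sum_congr rfl fun j _ => mul_comm _ _
  have i1 : ∀ i j, Integrable (fun x => g i j x * (comp τ i j : L2Pair V).fn x
      + g j i x * (comp τ i j : L2Pair V).fn x) (volume.restrict V) :=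
    fun i j => (hI _ _ _ _).add (hI _ _ _ _)
  rw [hrhs, integral_add (integrable_finsetSum _ fun i _ => integrable_finsetSum _ fun j _ =>
      i1 i j)
    ((integrable_finsetSum _ fun i _ => integrable_finsetSum _ fun j _ => hI _ _ _ _).const_mul c),
    integral_const_mul,
    integral_finsetSum _ fun i _ => integrable_finsetSum _ fun j _ => i1 i j,
    integral_finsetSum _ fun i _ => integrable_finsetSum _ fun j _ => hI _ _ _ _]
  simp only [add_apply, smul_apply, sum_apply, ContinuousLinearMap.comp_apply, smul_eq_mul, e]
  congr 1
  · refine Finset.sum_congr rfl fun i _ => ?_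
    rw [integral_finsetSum _ fun j _ => i1 i j]
    exact Finset.sum_congr rfl fun j _ => (integral_add (hI _ _ _ _) (hI _ _ _ _)).symm
  · congr 1
    refine Finset.sum_congr rfl fun i _ => ?_
    rw [integral_finsetSum _ fun j _ => hI _ _ _ _]

end StressWellPosed

theorem mainTheorem1 (V : Set StressWellPosed.E3) (hVo : IsOpen V) (hVb : Bornology.IsBounded V)
    (ν : ℝ) (hν : ν ∈ Set.Icc (0 : ℝ) (1 / 2)) :
    ∃ (a : StressWellPosed.X0 V →L[ℝ] StressWellPosed.X0 V →L[ℝ] ℝ) (β : ℝ),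
      -- `a` is the (continuous, symmetric, bilinear) stress form
      (∀ τ σ, a τ σ = StressWellPosed.stressForm ν τ σ) ∧
      (∀ τ σ, a τ σ = a σ τ) ∧
      (∀ τ σ, |a τ σ| ≤ (1 + 6 * StressWellPosed.chi ν) * ‖τ‖ * ‖σ‖) ∧
      -- coercivity
      0 < β ∧ (∀ σ, β * ‖σ‖ ^ 2 ≤ a σ σ) ∧
      -- well-posedness for every continuous linear form
      (∀ l : StressWellPosed.X0 V →L[ℝ] ℝ,
        (∃! σ, ∀ τ, a τ σ = l τ) ∧
        ∀ σ, (∀ τ, a τ σ = l τ) → ‖σ‖ ≤ 1 / β * ‖l‖) ∧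
      -- in particular for the linear form of every body force in `H¹(V)³`, which is continuous
      (∀ f : Fin 3 → StressWellPosed.H1 V, ∃ l : StressWellPosed.X0 V →L[ℝ] ℝ,
        (∀ τ, l τ = StressWellPosed.loadForm ν f τ) ∧
        (∃! σ, ∀ τ, a τ σ = StressWellPosed.loadForm ν f τ) ∧
        ∀ σ, (∀ τ, a τ σ = StressWellPosed.loadForm ν f τ) → ‖σ‖ ≤ 1 / β * ‖l‖) := by
  open StressWellPosed in
  have h0 : 0 ≤ chi ν := one_div_nonneg.2 (by linarith [hν.1])
  have h1 : chi ν ≤ 1 := div_le_one_of_le₀ (by linarith [hν.1]) (by linarith [hν.1])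
  obtain ⟨R, hR⟩ := hVb.exists_norm_le
  let a : X0 V →L[ℝ] X0 V →L[ℝ] ℝ :=
    (stressBilin V ν).mkContinuous₂ (1 + 6 * chi ν) (abs_stressForm_le h0)
  have hsymm : ∀ τ σ, a τ σ = a σ τ := stressForm_symm ν
  have hβ : 0 < 1 / (10 * (1 + 4 * R ^ 2)) := by positivity
  have hco : ∀ σ, 1 / (10 * (1 + 4 * R ^ 2)) * ‖σ‖ ^ 2 ≤ a σ σ := stressForm_coercive hVo hR h0 h1
  have hlm := lax_milgram a hsymm hβ hco
  refine ⟨a, _, fun _ _ => rfl, hsymm, abs_stressForm_le h0, hβ, hco, hlm, fun f => ?_⟩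
  obtain ⟨l, hl⟩ := exists_clm_eq_loadForm ν f
  simp only [← hl]
  exact ⟨l, fun _ => rfl, hlm l⟩
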